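/- Let $T$ be a tournament on $n\ge 1$ vertices $v_1,\dots,v_n$ (that is, an orientation of the complete graph $K_n$), and let $d_k^+$ be the out-degree of $v_k$. An arborescence of $T$ rooted at a vertex $v$ is a spanning tree of $T$ (a set of directed edges forming a spanning tree of the underlying undirected graph) in which $v$ has out-degree $0$ and every other vertex has out-degree $1$. Let $\mathrm{arb}(T,v)$ be the number of arborescences of $T$ rooted at $v$, and let $\mathrm{allarb}(T)=\sum_{v}\mathrm{arb}(T,v)$, where the sum runs over all vertices $v$ of $T$. Then $$\mathrm{allarb}(T)\ \ge\ \frac1n\left(\prod_{k=1}^n (d_k^+ +1)+\prod_{k=1}^n d_k^+\right).$$ Equality holds if and only if $T$ is locally transitive, meaning that for every vertex $v$ the set of out-neighbors of $v$ and the set of in-neighbors of $v$ each induce a transitive tournament (the empty tournament counts as transitive). -/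

import Mathlib

namespace Digraph

variable {V : Type*}

/-- The out-neighbours `N⁺(v)` of a vertex. -/
def outNeighborSet (D : Digraph V) (v : V) : Set V := {w | D.Adj v w}

/-- The in-neighbours `N⁻(v)` of a vertex. -/
def inNeighborSet (D : Digraph V) (v : V) : Set V := {w | D.Adj w v}

/-- The out-degree `d⁺(v)` of a vertex (meaningful when `N⁺(v)` is finite). -/
noncomputable def outDegree (D : Digraph V) (v : V) : ℕ := (D.outNeighborSet v).ncard

/-- The sub-digraph of `D` induced by a set of vertices. -/
def induce (D : Digraph V) (S : Set V) : Digraph S where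
  Adj u w := D.Adj u w

/-- A tournament: an orientation of the complete graph. There are no loops, and any two distinct
vertices are joined by an edge in exactly one of the two directions. -/
structure IsTournament (D : Digraph V) : Prop where
  loopless : ∀ v, ¬ D.Adj v v
  exactly_one : ∀ u v, u ≠ v → Xor (D.Adj u v) (D.Adj v u)

/-- A transitive tournament. -/
structure IsTransitiveTournament (D : Digraph V) : Prop where
  isTournament : D.IsTournament
  transitive : ∀ u v w, D.Adj u v → D.Adj v w → D.Adj u w

/-- A digraph is locally transitive if, for every vertex, the out-neighbours and the in-neighbours
both induce a transitive tournament. -/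
def IsLocallyTransitive (D : Digraph V) : Prop :=
  ∀ v, (D.induce (D.outNeighborSet v)).IsTransitiveTournament ∧
    (D.induce (D.inNeighborSet v)).IsTransitiveTournament

/-- `A` is an arborescence of `D` rooted at `r`: a sub-digraph of `D` on all the vertices, whose
underlying undirected graph is a tree, in which `r` has out-degree `0` and every other vertex has
out-degree `1`. -/
structure IsArborescence (D : Digraph V) (r : V) (A : Digraph V) : Prop where
  le : A ≤ D
  isTree : A.toSimpleGraphInclusive.IsTree
  outDegree_root : A.outDegree r = 0
  outDegree_of_ne : ∀ v, v ≠ r → A.outDegree v = 1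

/-- The number of arborescences of `D` rooted at `r`. -/
noncomputable def arb (D : Digraph V) (r : V) : ℕ := {A : Digraph V | D.IsArborescence r A}.ncard

/-- The total number of arborescences of `D`, over all roots. -/
noncomputable def allarb [Fintype V] (D : Digraph V) : ℕ := ∑ r, D.arb r

end Digraph

/-!
For a digraph on `n` vertices with out-degree Laplacian `L`, the matrix-tree theorem
(`Digraph.det_updateRow_laplacian`) identifies the arborescence counts with the principal cofactors
of `L`. As the rows of `L` sum to zero, `det (L + x J) = x n allarb`, where `J` is the all-ones
matrix (`Matrix.det_add_const_of_sum_row_eq_zero`).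

For a tournament, `L + J / 2 = diag (d + 1 / 2) - S / 2`, where `S` is the skew-adjacency matrix,
which is skew-symmetric with all off-diagonal entries `± 1`. Expanding the determinant over the
principal minors of `S` gives
`n allarb = 2 ∑_K (-1 / 2) ^ |K| det S_K ∏_{v ∉ K} (d_v + 1 / 2)`. The odd minors vanish. The even
minors are nonnegative because `S` is skew-symmetric, and odd integers because `S` is congruent to
`J - 1` modulo `2`, so they are at least `1` (`Matrix.one_le_det_of_skew`). Replacing each even
minor by `1` gives exactly `∏ (d_v + 1) + ∏ d_v`
(`Digraph.IsTournament.card_mul_allarb_sub`), which is the inequality.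

All the weights `d_v + 1 / 2` are positive, so equality holds exactly when every even principal
minor is `1`. The minors of order four are squares of Pfaffians with values `± 1` or `± 3`, and
`± 3` occurs exactly when one of the four vertices dominates, or is dominated by, a cyclic triangle
on the others; so local transitivity is the condition on minors of order four
(`Digraph.IsTournament.isLocallyTransitive_iff_pfaffianFour`). This condition implies that all even
minors are `1`: up to flipping signs of rows and columns, `S_K` is the sign matrix of a transitive
tournament (`Matrix.det_eq_one_of_pfaffianFour`).
-/

open Matrix Finset

/-! ### The matrix-tree theorem for arborescences -/

section functionalGraph

variable {V : Type*} [DecidableEq V]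

/-- The matrix of the functional graph of `f` with a sink at `r`: its row at `r` is `e_r`, and its
row at any other `v` is `e_v - e_{f v}`. -/
def sinkMatrix (r : V) (f : V → V) : Matrix V V ℝ :=
  fun v => Pi.single v 1 - if v = r then 0 else Pi.single (f v) 1

theorem sinkMatrix_apply (r : V) (f : V → V) (v w : V) :
    sinkMatrix r f v w =
      (if w = v then 1 else 0) - if v = r then 0 else if w = f v then 1 else 0 := by
  unfold sinkMatrix
  split_ifs <;> simp_all

/-- If every vertex reaches `r`, then `sinkMatrix r f` is unitriangular with respect to the number
of steps needed to reach `r`. -/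
theorem det_sinkMatrix_of_reach [Fintype V] {r : V} {f : V → V} (h : ∀ v, ∃ k, f^[k] v = r) :
    (sinkMatrix r f).det = 1 := by
  classical
  let b : V → ℕ := fun v => Nat.find (h v)
  have hb : ∀ v, v ≠ r → b (f v) < b v := by
    intro v hv
    have h1 : f^[b v] v = r := Nat.find_spec (h v)
    cases hk : b v with
    | zero => rw [hk] at h1; exact absurd h1 hv
    | succ k =>
      rw [hk, Function.iterate_succ_apply] at h1
      exact Nat.lt_succ_of_le (Nat.find_min' (h (f v)) h1)
  have htri : (sinkMatrix r f).BlockTriangular (OrderDual.toDual ∘ b) := by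
    intro i j hij
    have hij' : b i < b j := hij
    rw [sinkMatrix_apply, if_neg (by rintro rfl; exact lt_irrefl _ hij')]
    split_ifs with h1 h2
    · simp
    · exact absurd (hb i h1) (by rw [← h2]; omega)
    · simp
  rw [htri.det]
  refine Finset.prod_eq_one fun a _ => ?_
  have : (sinkMatrix r f).toSquareBlock (OrderDual.toDual ∘ b) a = 1 := by
    ext ⟨i, hi⟩ ⟨j, hj⟩
    have hij : b i = b j := OrderDual.toDual.injective (hi.trans hj.symm)
    simp only [toSquareBlock_def, of_apply, sinkMatrix_apply, one_apply, Subtype.mk.injEq]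
    have : ¬ (i ≠ r ∧ j = f i) := by
      rintro ⟨h1, rfl⟩
      exact absurd (hb i h1) (by omega)
    by_cases h1 : i = r <;> by_cases h2 : j = f i <;> simp_all [eq_comm]
  rw [this, det_one]

/-- If some vertex never reaches `r`, then the indicator vector of the set of all such vertices is
in the kernel of `sinkMatrix r f`. -/
theorem det_sinkMatrix_of_not_reach [Fintype V] {r : V} {f : V → V} (h : ¬ ∀ v, ∃ k, f^[k] v = r) :
    (sinkMatrix r f).det = 0 := by
  classical
  push Not at h
  obtain ⟨v, hv⟩ := h
  let x : V → ℝ := fun w => if ∀ k, f^[k] w ≠ r then 1 else 0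
  refine exists_mulVec_eq_zero_iff.mp ⟨x, fun h0 => ?_, ?_⟩
  · have := congrFun h0 v
    simp [x, hv] at this
  · ext w
    have hxr : x r = 0 := if_neg fun h => h 0 rfl
    have hxf : w ≠ r → x (f w) = x w := by
      intro hw
      refine if_congr ⟨fun h k => ?_, fun h k => h (k + 1)⟩ rfl rfl
      cases k with
      | zero => exact hw
      | succ k => exact h k
    simp only [mulVec, dotProduct, sinkMatrix_apply, sub_mul, Finset.sum_sub_distrib]
    by_cases hw : w = r
    · simp [hw, hxr]
    · simp [hw, hxf hw]

end functionalGraph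

namespace Digraph

variable {V : Type*}

/-- The parent functions of arborescences rooted at `r`: the root is a fixed point, every other
vertex is sent along an edge, and iteration leads from every vertex to the root. -/
def parentFunctions (D : Digraph V) (r : V) : Set (V → V) :=
  {f | (f r = r ∧ ∀ v, v ≠ r → D.Adj v (f v)) ∧ ∀ v, ∃ k, f^[k] v = r}

/-- The digraph with an edge from every `v ≠ r` to `f v`. -/
def ofParent (r : V) (f : V → V) : Digraph V where
  Adj v w := v ≠ r ∧ w = f v

theorem ofParent_injOn (r : V) : Set.InjOn (ofParent r) {f | f r = r} := by
  intro f hf g hg h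
  ext v
  by_cases hv : v = r
  · subst hv
    exact hf.trans hg.symm
  · have : (ofParent r g).Adj v (f v) := h ▸ ⟨hv, rfl⟩
    exact this.2

theorem ofParent_isArborescence [Fintype V] {D : Digraph V} {r : V} {f : V → V}
    (hf : f ∈ D.parentFunctions r) : D.IsArborescence r (ofParent r f) := by
  classical
  obtain ⟨⟨-, h⟩, hreach⟩ := hf
  have hne : ∀ v, v ≠ r → v ≠ f v := by
    intro v hv hfix
    obtain ⟨k, hk⟩ := hreach v
    exact hv ((Function.iterate_fixed hfix.symm k).symm.trans hk)
  set G := (ofParent r f).toSimpleGraphInclusive with hG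
  have hadj : ∀ v, v ≠ r → G.Adj v (f v) := fun v hv =>
    (SimpleGraph.fromRel_adj _ _ _).mpr ⟨hne v hv, Or.inl ⟨hv, rfl⟩⟩
  have hr : ∀ k v, f^[k] v = r → G.Reachable v r := by
    intro k
    induction k with
    | zero => rintro v rfl; exact SimpleGraph.Reachable.refl _
    | succ k ih =>
      intro v hv
      by_cases hvr : v = r
      · rw [hvr]
      · exact (hadj v hvr).reachable.trans (ih _ hv)
  have hconn : G.Connected := by
    have : Nonempty V := ⟨r⟩
    exact ⟨fun u v => (hr _ u (hreach u).choose_spec).trans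
      (hr _ v (hreach v).choose_spec).symm⟩
  -- The map `v ↦ {v, f v}` from the vertices other than `r` to the edges is onto.
  have hsub : G.edgeSet ⊆ ((univ.erase r).image fun v => s(v, f v) : Finset (Sym2 V)) := by
    intro e
    induction e with
    | _ v w =>
      intro he
      obtain ⟨-, ⟨h1, h2⟩ | ⟨h1, h2⟩⟩ := (SimpleGraph.fromRel_adj _ _ _).mp he
      · simp only [coe_image, Set.mem_image, mem_coe, mem_erase, mem_univ, and_true]
        exact ⟨v, h1, congrArg (fun x => s(v, x)) h2.symm⟩
      · simp only [coe_image, Set.mem_image, mem_coe, mem_erase, mem_univ, and_true]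
        exact ⟨w, h1, (congrArg (fun x => s(w, x)) h2.symm).trans Sym2.eq_swap⟩
  have hcard : Nat.card G.edgeSet + 1 ≤ Nat.card V := by
    have h1 := Set.ncard_le_ncard hsub (Finset.finite_toSet _)
    rw [Set.ncard_coe_finset] at h1
    have h2 := h1.trans Finset.card_image_le
    rw [Finset.card_erase_of_mem (mem_univ r), Finset.card_univ] at h2
    have h3 : 0 < Fintype.card V := Fintype.card_pos_iff.mpr ⟨r⟩
    rw [Nat.card_coe_set_eq, Nat.card_eq_fintype_card]
    omega
  refine ⟨?_, ?_, ?_, ?_⟩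
  · rintro v w ⟨hv, rfl⟩
    exact h v hv
  · exact SimpleGraph.isTree_iff_connected_and_card.mpr
      ⟨hconn, le_antisymm hcard hconn.card_vert_le_card_edgeSet_add_one⟩
  · simp [outDegree, outNeighborSet, ofParent]
  · intro v hv
    have : (ofParent r f).outNeighborSet v = {f v} := by
      ext w; simp [outNeighborSet, ofParent, hv]
    rw [outDegree, this, Set.ncard_singleton]

/-- Every arborescence comes from a parent function. The vertices that do not reach the root along
the parent function are closed under adjacency in the underlying graph, so there are none. -/
theorem IsArborescence.exists_parentFunction [Fintype V] {D A : Digraph V} {r : V}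
    (hA : D.IsArborescence r A) : ∃ f ∈ D.parentFunctions r, ofParent r f = A := by
  classical
  have hout : ∀ v, ∃ w, (v = r → w = r) ∧ (v ≠ r → A.outNeighborSet v = {w}) := by
    intro v
    by_cases hv : v = r
    · exact ⟨r, by simp [hv]⟩
    · obtain ⟨w, hw⟩ := Set.ncard_eq_one.mp (hA.outDegree_of_ne v hv)
      exact ⟨w, by simp [hv, hw]⟩
  choose f hfr hf using hout
  have hroot : A.outNeighborSet r = ∅ :=
    (Set.ncard_eq_zero (Set.toFinite _)).mp hA.outDegree_root
  have hiff : ∀ v w, A.Adj v w ↔ v ≠ r ∧ w = f v := by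
    intro v w
    by_cases hv : v = r
    · subst hv
      have : ¬ A.Adj v w := fun h => hroot.subset h
      simp [this]
    · have : A.Adj v w ↔ w ∈ ({f v} : Set V) := by rw [← hf v hv]; rfl
      simpa [hv] using this
  have hstep : ∀ v, v ≠ r → ((∃ k, f^[k] (f v) = r) ↔ ∃ k, f^[k] v = r) := by
    intro v hv
    constructor
    · rintro ⟨k, hk⟩
      exact ⟨k + 1, hk⟩
    · rintro ⟨k, hk⟩
      cases k with
      | zero => exact absurd hk hv
      | succ k => exact ⟨k, hk⟩
  have hwalk : ∀ v w, A.toSimpleGraphInclusive.Walk v w →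
      (∃ k, f^[k] w = r) → ∃ k, f^[k] v = r := by
    intro v w p
    induction p with
    | nil => exact id
    | cons hadj _ ih =>
      intro hw
      obtain ⟨-, h1 | h1⟩ := (SimpleGraph.fromRel_adj _ _ _).mp hadj
      · obtain ⟨h2, rfl⟩ := (hiff _ _).mp h1
        exact (hstep _ h2).mp (ih hw)
      · obtain ⟨h2, rfl⟩ := (hiff _ _).mp h1
        exact (hstep _ h2).mpr (ih hw)
  refine ⟨f, ⟨⟨hfr r rfl, fun v hv => hA.le ((hiff _ _).mpr ⟨hv, rfl⟩)⟩, fun v => ?_⟩, ?_⟩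
  · obtain ⟨p⟩ := hA.isTree.connected.preconnected v r
    exact hwalk v r p ⟨0, rfl⟩
  · ext v w
    exact (hiff v w).symm

theorem arb_eq_ncard_parentFunctions [Fintype V] (D : Digraph V) (r : V) :
    D.arb r = (D.parentFunctions r).ncard := by
  have : {A : Digraph V | D.IsArborescence r A} = ofParent r '' D.parentFunctions r := by
    ext A
    constructor
    · exact fun hA => hA.exists_parentFunction
    · rintro ⟨f, hf, rfl⟩
      exact ofParent_isArborescence hf
  rw [arb, this, Set.InjOn.ncard_image]
  exact (ofParent_injOn r).mono fun f hf => hf.1.1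

open Classical in
/-- The out-degree Laplacian of a digraph. -/
noncomputable def laplacian [Fintype V] (D : Digraph V) : Matrix V V ℝ :=
  fun v w => (if w = v then (D.outDegree v : ℝ) else 0) - if D.Adj v w then 1 else 0

open Classical in
theorem outDegree_eq_sum [Fintype V] (D : Digraph V) (v : V) :
    (D.outDegree v : ℝ) = ∑ w, if D.Adj v w then 1 else 0 := by
  rw [outDegree, outNeighborSet, Set.ncard_eq_toFinset_card', Finset.sum_boole]
  simp

theorem sum_laplacian [Fintype V] (D : Digraph V) (v : V) : ∑ w, D.laplacian v w = 0 := by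
  classical
  simp only [laplacian, Finset.sum_sub_distrib, ← outDegree_eq_sum]
  simp

/-- The directed matrix-tree theorem. Expanding the rows of the determinant expresses it as a sum
over all candidate parent functions `f`, weighted by the determinant of `sinkMatrix r f`. -/
theorem det_updateRow_laplacian [Fintype V] [DecidableEq V] (D : Digraph V) (r : V) :
    (D.laplacian.updateRow r (Pi.single r 1)).det = D.arb r := by
  classical
  let c : V → V → ℝ := fun v w =>
    if v = r then (if w = r then 1 else 0) else if D.Adj v w then 1 else 0
  let g : V → V → V → ℝ := fun v w => Pi.single v 1 - if v = r then 0 else Pi.single w 1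
  have hrow : D.laplacian.updateRow r (Pi.single r 1) = fun v => ∑ w, c v w • g v w := by
    ext v u
    simp only [Finset.sum_apply, Pi.smul_apply, smul_eq_mul]
    by_cases hv : v = r
    · subst hv
      simp [c, g]
    · rw [updateRow_ne hv]
      simp only [c, g, hv, if_false, laplacian, outDegree_eq_sum, Pi.sub_apply, mul_sub,
        Finset.sum_sub_distrib, Pi.single_apply, ← Finset.sum_mul]
      congr 1
      · split_ifs <;> simp
      · simp
  have hprod : ∀ f : V → V,
      ∏ v, c v (f v) = if f r = r ∧ ∀ v, v ≠ r → D.Adj v (f v) then 1 else 0 := by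
    intro f
    have : ∀ v, c v (f v) =
        if (v = r → f r = r) ∧ (v ≠ r → D.Adj v (f v)) then 1 else 0 := by
      intro v
      by_cases hv : v = r
      · subst hv; simp [c]
      · simp [c, hv]
    simp only [this, Fintype.prod_boole]
    refine if_congr ⟨fun h => ⟨(h r).1 rfl, fun v => (h v).2⟩,
      fun h v => ⟨fun _ => h.1, h.2 v⟩⟩ rfl rfl
  calc (D.laplacian.updateRow r (Pi.single r 1)).det
      = detRowAlternating (fun v => ∑ w, c v w • g v w) := by rw [hrow]; rfl
    _ = ∑ f : V → V, (∏ v, c v (f v)) * (sinkMatrix r f).det := by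
        rw [← AlternatingMap.coe_multilinearMap, MultilinearMap.map_sum]
        refine Finset.sum_congr rfl fun f _ => ?_
        rw [MultilinearMap.map_smul_univ]
        rfl
    _ = ∑ f : V → V, if f ∈ D.parentFunctions r then 1 else 0 := by
        refine Finset.sum_congr rfl fun f _ => ?_
        rw [hprod]
        by_cases h : ∀ v, ∃ k, f^[k] v = r
        · rw [det_sinkMatrix_of_reach h, mul_one]
          exact if_congr (by simp [parentFunctions, h]) rfl rfl
        · rw [det_sinkMatrix_of_not_reach h, mul_zero, if_neg fun h' => h h'.2]
    _ = D.arb r := by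
        rw [arb_eq_ncard_parentFunctions, Finset.sum_boole, Set.ncard_eq_toFinset_card']
        congr 2
        ext; simp

end Digraph

/-! ### Determinants of rank-one perturbations and of sums with diagonal matrices -/

namespace Matrix

variable {n : Type*} [Fintype n] [DecidableEq n]

/-- If the rows of `L` sum to zero, then `det (L + x J)`, where `J` is the all-ones matrix, is
`x |n|` times the sum of the principal cofactors of `L`. Cramer's rule applies to `L + x J` because
this matrix sends the all-ones vector to a multiple of itself. -/
theorem det_add_const_of_sum_row_eq_zero [Nonempty n] (L : Matrix n n ℝ)
    (hL : ∀ i, ∑ j, L i j = 0) (x : ℝ) :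
    (L + of fun _ _ => x).det =
      x * Fintype.card n * ∑ i, (L.updateRow i (Pi.single i 1)).det := by
  obtain ⟨r⟩ := ‹Nonempty n›
  have hmul : (L + of fun _ _ => x) *ᵥ 1 = (x * Fintype.card n) • 1 := by
    ext i
    simp [mulVec, dotProduct, Finset.sum_add_distrib, hL, mul_comm]
  have h1 : (L + of fun _ _ => x).det =
      x * Fintype.card n * ((L + of fun _ _ => x).updateCol r 1).det := by
    have h2 := congrFun (cramer_eq_adjugate_mulVec (L + of fun _ _ => x)
      ((L + of fun _ _ => x) *ᵥ 1)) r
    rw [mulVec_mulVec, adjugate_mul, hmul, map_smul, Pi.smul_apply, cramer_apply, smul_mulVec,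
      one_mulVec] at h2
    simpa using h2.symm
  have h2 : ((L + of fun _ _ => x).updateCol r 1).det = (L.updateCol r 1).det := by
    rw [← det_transpose, ← det_transpose (L.updateCol r 1)]
    refine det_eq_of_forall_row_eq_smul_add_const (fun j => if j = r then 0 else x) r (by simp) ?_
    intro i j
    by_cases hi : i = r
    · subst hi; simp
    · simp [hi]
  have h3 : ∀ i, (L.updateRow i (Pi.single r 1)).det = (L.updateRow i (Pi.single i 1)).det := by
    intro i
    rw [← sub_eq_zero]
    have hz : (L.updateRow i (Pi.single r 1 - Pi.single i 1)).det = 0 := by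
      refine exists_mulVec_eq_zero_iff.mp ⟨1, fun h => by simpa using congrFun h r, ?_⟩
      ext j
      by_cases hj : j = i
      · subst hj; simp [mulVec, dotProduct, Finset.sum_sub_distrib]
      · simp [mulVec, dotProduct, updateRow_ne hj, hL]
    have hadd := det_updateRow_add L i (Pi.single r 1 - Pi.single i 1) (Pi.single i 1)
    rw [sub_add_cancel, hz] at hadd
    linarith
  have h4 : (L.updateCol r 1).det = ∑ i, (L.updateRow i (Pi.single r 1)).det := by
    rw [← cramer_apply, cramer_eq_adjugate_mulVec]
    simp [mulVec, dotProduct, adjugate_apply]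
  rw [h1, h2, h4, Finset.sum_congr rfl fun i _ => h3 i]

/-- Expansion of `det (M + diagonal d)` in the principal minors of `M`. -/
theorem det_add_diagonal (M : Matrix n n ℝ) (d : n → ℝ) :
    (M + diagonal d).det =
      ∑ s : Finset n, (M.submatrix (Subtype.val : s → n) Subtype.val).det *
        ∏ i ∈ univ \ s, d i := by
  have hrow : M + diagonal d = fun i => M i + d i • (1 : Matrix n n ℝ) i := by
    ext i j
    simp [diagonal_apply, one_apply]
  calc (M + diagonal d).det
      = detRowAlternating (M.row + fun i => d i • (1 : Matrix n n ℝ) i) := by rw [hrow]; rfl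
    _ = _ := by
        rw [← AlternatingMap.coe_multilinearMap, MultilinearMap.map_add_univ]
        refine Finset.sum_congr rfl fun s _ => ?_
        rw [← det_piecewise_one_eq_submatrix_det M s]
        have : s.piecewise M.row (fun i => d i • (1 : Matrix n n ℝ) i) =
            fun i => (s.piecewise 1 d : n → ℝ) i • s.piecewise M.row (1 : Matrix n n ℝ).row i := by
          ext i j
          by_cases hi : i ∈ s <;> simp [Finset.piecewise, hi, Matrix.row]
        rw [this, MultilinearMap.map_smul_univ, smul_eq_mul, mul_comm, Finset.prod_piecewise]
        simp only [Pi.one_apply, Finset.prod_const_one, one_mul]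
        rfl

/-! ### Determinants of skew-symmetric matrices -/

theorem det_eq_zero_of_skew_of_odd_card {M : Matrix n n ℤ} (hM : Mᵀ = -M)
    (hn : Odd (Fintype.card n)) : M.det = 0 := by
  have h := det_transpose M
  rw [hM, det_neg, hn.neg_one_pow] at h
  omega

/-- The segment from the identity to a skew-symmetric matrix meets no singular matrix, except
possibly at its end. -/
theorem det_nonneg_of_skew {M : Matrix n n ℝ} (hM : Mᵀ = -M) : 0 ≤ M.det := by
  by_contra! hneg
  let p : ℝ → ℝ := fun t => (t • (1 : Matrix n n ℝ) + (1 - t) • M).det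
  have hp : Continuous p := by
    refine Continuous.matrix_det ?_
    fun_prop
  have h0 : p 0 < 0 := by simpa [p] using hneg
  have h1 : p 1 = 1 := by simp [p]
  obtain ⟨t, ht, hpt⟩ := intermediate_value_Icc zero_le_one hp.continuousOn
    (show (0 : ℝ) ∈ Set.Icc (p 0) (p 1) from ⟨h0.le, by rw [h1]; exact zero_le_one⟩)
  have ht0 : t ≠ 0 := by rintro rfl; exact h0.ne hpt
  obtain ⟨x, hx0, hx⟩ := exists_mulVec_eq_zero_iff.mpr hpt
  have hskew : x ⬝ᵥ M *ᵥ x = 0 := by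
    have h : x ⬝ᵥ M *ᵥ x = x ⬝ᵥ Mᵀ *ᵥ x := by
      rw [mulVec_transpose, dotProduct_comm x (x ᵥ* M), ← dotProduct_mulVec]
    rw [hM, neg_mulVec, dotProduct_neg] at h
    linarith
  have h := congrArg (x ⬝ᵥ ·) hx
  simp only [add_mulVec, smul_mulVec, one_mulVec, dotProduct_add, dotProduct_smul, hskew,
    dotProduct_zero, smul_eq_mul, mul_zero, add_zero] at h
  exact hx0 (dotProduct_self_eq_zero.mp ((mul_eq_zero.mp h).resolve_left ht0))

/-- Modulo `2` such a matrix is `J + 1`, where `J` is the all-ones matrix, and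
`det (J + 1) = |n| + 1`. -/
theorem odd_det_of_odd_off_diagonal {M : Matrix n n ℤ} (hdiag : ∀ i, M i i = 0)
    (hodd : ∀ i j, i ≠ j → Odd (M i j)) (hn : Even (Fintype.card n)) : Odd M.det := by
  have hmod : M.map (Int.castRingHom (ZMod 2)) =
      1 + replicateCol Unit (1 : n → ZMod 2) * replicateRow Unit (1 : n → ZMod 2) := by
    ext i j
    by_cases hij : i = j
    · subst hij
      simp [hdiag, mul_apply]
      decide
    · have := (ZMod.intCast_eq_one_iff_odd).mpr (hodd i j hij)
      simp [mul_apply, one_apply_ne hij, this]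
  have hdet : ((M.det : ℤ) : ZMod 2) = 1 := by
    have h := RingHom.map_det (Int.castRingHom (ZMod 2)) M
    rw [RingHom.mapMatrix_apply, hmod, det_one_add_replicateCol_mul_replicateRow] at h
    have hc : ((Fintype.card n : ℕ) : ZMod 2) = 0 :=
      (ZMod.natCast_eq_zero_iff_even).mpr hn
    simpa [hc] using h
  exact ZMod.intCast_eq_one_iff_odd.mp hdet

theorem one_le_det_of_skew {M : Matrix n n ℤ} (hM : Mᵀ = -M)
    (hodd : ∀ i j, i ≠ j → Odd (M i j)) (hn : Even (Fintype.card n)) : 1 ≤ M.det := by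
  have hdiag : ∀ i, M i i = 0 := fun i => by
    have := congrFun (congrFun hM i) i
    simp only [transpose_apply, neg_apply] at this
    omega
  have h1 := odd_det_of_odd_off_diagonal hdiag hodd hn
  have h2 : 0 ≤ (M.map (Int.cast : ℤ → ℝ)).det := by
    refine det_nonneg_of_skew ?_
    ext i j
    have := congrFun (congrFun hM i) j
    simp only [transpose_apply, neg_apply] at this
    simp [this]
  have h3 : (M.map (Int.cast : ℤ → ℝ)).det = M.det := (Int.cast_det M).symm
  rw [h3] at h2
  have h4 : 0 ≤ M.det := by exact_mod_cast h2
  obtain ⟨k, hk⟩ := h1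
  omega

/-- A symmetric rank-one perturbation does not change the determinant of an invertible
skew-symmetric matrix `M`, since `u ⬝ᵥ M⁻¹ *ᵥ u = 0`. -/
theorem det_add_vecMulVec_self_of_skew {M : Matrix n n ℝ} (hM : Mᵀ = -M) (hdet : M.det ≠ 0)
    (u : n → ℝ) : (M + vecMulVec u u).det = M.det := by
  have hu : IsUnit M.det := isUnit_iff_ne_zero.mpr hdet
  have hinv : (M⁻¹)ᵀ = -M⁻¹ := by
    rw [transpose_nonsing_inv, hM]
    refine inv_eq_right_inv ?_
    rw [neg_mul_neg, mul_nonsing_inv _ hu]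
  have hq : u ⬝ᵥ M⁻¹ *ᵥ u = 0 := by
    have h : u ⬝ᵥ M⁻¹ *ᵥ u = u ⬝ᵥ (M⁻¹)ᵀ *ᵥ u := by
      rw [mulVec_transpose, dotProduct_comm u (u ᵥ* M⁻¹), ← dotProduct_mulVec]
    rw [hinv, neg_mulVec, dotProduct_neg] at h
    linarith
  rw [vecMulVec_eq Unit, det_add_replicateCol_mul_replicateRow hu]
  have : (1 + replicateRow Unit u * M⁻¹ * replicateCol Unit u).det = 1 + u ⬝ᵥ M⁻¹ *ᵥ u := by
    rw [det_unique, Matrix.mul_assoc, add_apply, one_apply_eq, ← replicateCol_mulVec,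
      replicateRow_mul_replicateCol_apply]
  rw [this, hq, add_zero, mul_one]

end Matrix

/-! ### Skew-symmetric sign matrices all of whose 4 × 4 Pfaffians are signs -/

namespace Matrix

variable {n : Type*}

/-- The Pfaffian of the principal 4 × 4 submatrix of a skew-symmetric matrix on `i, j, k, l`. -/
def pfaffianFour (M : Matrix n n ℤ) (i j k l : n) : ℤ :=
  M i j * M k l - M i k * M j l + M i l * M j k

theorem det_submatrix_four {M : Matrix n n ℤ} (hM : Mᵀ = -M) (i j k l : n) :
    (M.submatrix ![i, j, k, l] ![i, j, k, l]).det = M.pfaffianFour i j k l ^ 2 := by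
  have h : ∀ a b, M b a = -M a b := fun a b => congrFun (congrFun hM a) b
  have h0 : ∀ a, M a a = 0 := fun a => by have := h a a; omega
  have : M.submatrix ![i, j, k, l] ![i, j, k, l] =
      !![0, M i j, M i k, M i l; -M i j, 0, M j k, M j l;
        -M i k, -M j k, 0, M k l; -M i l, -M j l, -M k l, 0] := by
    ext a b
    fin_cases a <;> fin_cases b <;> simp [h0, ← h]
  rw [this, pfaffianFour]
  simp [det_succ_row_zero, Fin.sum_univ_succ, Fin.succAbove]
  ring

variable [Fintype n] [DecidableEq n]

/-- Flipping signs of rows and columns with the entries of the row of a vertex `v` turns `M` into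
the sign matrix of a tournament dominated by `v`. It has no cyclic triangle, by the condition on
Pfaffians of quadruples containing `v`, so it is transitive, and adding the rank-one matrix
`u uᵀ`, where `u` is the row of `v` with diagonal entry `1`, makes `M` unitriangular. -/
theorem det_eq_one_of_pfaffianFour {M : Matrix n n ℤ} (hM : Mᵀ = -M)
    (hsign : ∀ i j, i ≠ j → M i j = 1 ∨ M i j = -1)
    (hpf : ∀ i j k l, i ≠ j → i ≠ k → i ≠ l → j ≠ k → j ≠ l → k ≠ l →
      M.pfaffianFour i j k l ^ 2 = 1)
    (hn : Even (Fintype.card n)) : M.det = 1 := by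
  classical
  rcases isEmpty_or_nonempty n with hempty | ⟨⟨v⟩⟩
  · exact det_isEmpty
  have hskew : ∀ a b, M b a = -M a b := fun a b => congrFun (congrFun hM a) b
  have h0 : ∀ a, M a a = 0 := fun a => by have := hskew a a; omega
  let u : n → ℤ := fun i => if i = v then 1 else M v i
  have hu : ∀ i, u i = 1 ∨ u i = -1 := by
    intro i
    by_cases hi : i = v
    · simp [u, hi]
    · simpa [u, hi] using hsign v i (Ne.symm hi)
  have huv : u v = 1 := if_pos rfl
  have hui : ∀ i, i ≠ v → M v i = u i := fun i hi => (if_neg hi).symm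
  let R : n → n → Prop := fun i j => i ≠ j ∧ M i j = u i * u j
  have hRv : ∀ i, ¬ R i v := by
    rintro i ⟨h1, h2⟩
    rw [hskew v i, hui i h1, huv] at h2
    have := hu i
    omega
  have hcases : ∀ i j, i ≠ j → M i j = u i * u j ∨ M i j = -(u i * u j) := by
    intro i j hij
    rcases hsign i j hij with h | h <;> rcases hu i with hi | hi <;> rcases hu j with hj | hj <;>
      rw [h, hi, hj] <;> norm_num
  have hne : ∀ i j, u i * u j ≠ -(u i * u j) := by
    intro i j
    rcases hu i with hi | hi <;> rcases hu j with hj | hj <;> rw [hi, hj] <;> norm_num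
  have hasymm : ∀ i j, R i j → ¬ R j i := by
    rintro i j ⟨-, h1⟩ ⟨-, h2⟩
    rw [hskew i j, h1, mul_comm (u j)] at h2
    exact hne i j h2.symm
  have htotal : ∀ i j, i ≠ j → ¬ R i j → R j i := by
    intro i j hij hR
    refine ⟨hij.symm, ?_⟩
    rw [hskew i j, (hcases i j hij).resolve_left fun h => hR ⟨hij, h⟩]
    ring
  have htrans : ∀ i j k, R i j → R j k → R i k := by
    intro i j k hij hjk
    have hik : i ≠ k := by rintro rfl; exact hasymm _ _ hij hjk
    by_contra hR
    have hki := htotal i k hik hR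
    have hiv : i ≠ v := by rintro rfl; exact hRv _ hki
    have hjv : j ≠ v := by rintro rfl; exact hRv _ hij
    have hkv : k ≠ v := by rintro rfl; exact hRv _ hjk
    have hp := hpf v i j k hiv.symm hjv.symm hkv.symm hij.1 hik hjk.1
    rw [pfaffianFour, hui i hiv, hui j hjv, hui k hkv, hskew k i, hij.2, hjk.2, hki.2] at hp
    rcases hu i with hi | hi <;> rcases hu j with hj | hj <;> rcases hu k with hk | hk <;>
      rw [hi, hj, hk] at hp <;> norm_num at hp
  have hR : IsStrictTotalOrder n R :=
    { irrefl := fun i h => h.1 rfl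
      trans := htrans
      trichotomous := fun i j h1 h2 => by
        by_contra hij
        exact h2 (htotal i j hij h1) }
  let : LinearOrder n := linearOrderOfSTO R
  have hdet : (M.map (Int.cast : ℤ → ℝ)).det = M.det := (Int.cast_det M).symm
  have h1 : 1 ≤ M.det := by
    refine one_le_det_of_skew hM (fun i j hij => ?_) hn
    rcases hsign i j hij with h | h <;> rw [h] <;> decide
  have h2 := det_add_vecMulVec_self_of_skew (M := M.map (Int.cast : ℤ → ℝ))
    (by ext i j; simp [hskew i j]) (by rw [hdet]; exact_mod_cast (by omega : M.det ≠ 0))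
    (fun i => (u i : ℝ))
  rw [hdet, det_of_isUpperTriangular] at h2
  · have h3 : ∀ i, (M.map (Int.cast : ℤ → ℝ) + vecMulVec (fun i => (u i : ℝ)) fun i => u i) i i
        = 1 := by
      intro i
      rcases hu i with hi | hi <;> simp [h0, vecMulVec_apply, hi]
    simp only [h3, Finset.prod_const_one] at h2
    exact_mod_cast h2.symm
  · intro i j hij
    have hji : R j i := hij
    have h4 : M i j = -(u i * u j) :=
      (hcases i j hji.1.symm).resolve_left fun h => hasymm j i hji ⟨hji.1.symm, h⟩
    simp [vecMulVec_apply, h4]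

end Matrix

/-! ### Tournaments -/

namespace Digraph

variable {V : Type*}

open Classical in
/-- The skew-adjacency matrix of a digraph: adjacency matrix minus its transpose. -/
noncomputable def skewAdj (D : Digraph V) : Matrix V V ℤ :=
  fun v w => (if D.Adj v w then 1 else 0) - if D.Adj w v then 1 else 0

theorem skewAdj_transpose (D : Digraph V) : D.skewAdjᵀ = -D.skewAdj := by
  ext v w
  simp [skewAdj]

theorem skewAdj_swap (D : Digraph V) (v w : V) : D.skewAdj w v = -D.skewAdj v w := by
  simp [skewAdj]

namespace IsTournament

variable {T : Digraph V}

theorem not_adj_swap (hT : T.IsTournament) {v w : V} (h : T.Adj v w) : ¬ T.Adj w v := by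
  intro h'
  by_cases hvw : v = w
  · subst hvw
    exact hT.loopless v h
  · rcases hT.exactly_one v w hvw with ⟨-, h2⟩ | ⟨-, h2⟩
    · exact h2 h'
    · exact h2 h

theorem adj_or_adj (hT : T.IsTournament) {v w : V} (h : v ≠ w) : T.Adj v w ∨ T.Adj w v := by
  rcases hT.exactly_one v w h with ⟨h, -⟩ | ⟨h, -⟩
  · exact Or.inl h
  · exact Or.inr h

theorem ne_of_adj (hT : T.IsTournament) {v w : V} (h : T.Adj v w) : v ≠ w := by
  rintro rfl
  exact hT.loopless v h

theorem skewAdj_eq_one_iff (hT : T.IsTournament) {v w : V} : T.skewAdj v w = 1 ↔ T.Adj v w := by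
  by_cases h : T.Adj v w
  · simp [skewAdj, h, hT.not_adj_swap h]
  · simp only [skewAdj, h, if_false, iff_false]
    split_ifs <;> norm_num

theorem skewAdj_eq_neg_one_iff (hT : T.IsTournament) {v w : V} :
    T.skewAdj v w = -1 ↔ T.Adj w v := by
  rw [T.skewAdj_swap w v, neg_inj, hT.skewAdj_eq_one_iff]

theorem skewAdj_eq_one_or (hT : T.IsTournament) {v w : V} (h : v ≠ w) :
    T.skewAdj v w = 1 ∨ T.skewAdj v w = -1 :=
  (hT.adj_or_adj h).imp hT.skewAdj_eq_one_iff.mpr hT.skewAdj_eq_neg_one_iff.mpr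

/-- Local transitivity forbids the two tournaments on four vertices in which a vertex dominates, or
is dominated by, a cyclic triangle. -/
theorem isLocallyTransitive_iff (hT : T.IsTournament) :
    T.IsLocallyTransitive ↔ ∀ v a b c, v ≠ a → v ≠ b → v ≠ c → a ≠ b → a ≠ c → b ≠ c →
      ¬ (T.skewAdj v a = T.skewAdj v b ∧ T.skewAdj v b = T.skewAdj v c ∧
        T.skewAdj a b = T.skewAdj b c ∧ T.skewAdj b c = T.skewAdj c a) := by
  constructor
  · rintro h v a b c hva hvb hvc hab - - ⟨h1, h2, h3, h4⟩
    have hout : ∀ x y z, T.Adj v x → T.Adj v y → T.Adj v z → T.Adj x y → T.Adj y z →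
        T.Adj x z := fun x y z hx hy hz hxy hyz =>
      (h v).1.transitive ⟨x, hx⟩ ⟨y, hy⟩ ⟨z, hz⟩ hxy hyz
    have hin : ∀ x y z, T.Adj x v → T.Adj y v → T.Adj z v → T.Adj x y → T.Adj y z →
        T.Adj x z := fun x y z hx hy hz hxy hyz =>
      (h v).2.transitive ⟨x, hx⟩ ⟨y, hy⟩ ⟨z, hz⟩ hxy hyz
    rcases hT.skewAdj_eq_one_or hva with e1 | e1 <;>
    rcases hT.skewAdj_eq_one_or hab with e2 | e2 <;>
      (rw [e1] at h1; rw [← h1] at h2; rw [e2] at h3; rw [← h3] at h4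
       replace h1 := h1.symm
       replace h2 := h2.symm
       replace h3 := h3.symm
       replace h4 := h4.symm
       simp only [hT.skewAdj_eq_one_iff, hT.skewAdj_eq_neg_one_iff] at h1 h2 h3 h4 e1 e2)
    · exact hT.not_adj_swap h4 (hout a b c e1 h1 h2 e2 h3)
    · exact hT.not_adj_swap h4 (hout c b a h2 h1 e1 h3 e2)
    · exact hT.not_adj_swap h4 (hin a b c e1 h1 h2 e2 h3)
    · exact hT.not_adj_swap h4 (hin c b a h2 h1 e1 h3 e2)
  · intro h v
    have hind : ∀ S : Set V, (T.induce S).IsTournament := fun S =>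
      ⟨fun x => hT.loopless x, fun x y hxy =>
        hT.exactly_one x y fun h => hxy (Subtype.ext h)⟩
    have hcyc : ∀ a b c, v ≠ a → v ≠ b → v ≠ c → T.skewAdj v a = T.skewAdj v b →
        T.skewAdj v b = T.skewAdj v c → T.Adj a b → T.Adj b c → T.Adj a c := by
      intro a b c hva hvb hvc h1 h2 hab hbc
      have hac : a ≠ c := by rintro rfl; exact hT.not_adj_swap hab hbc
      by_contra hn
      have hca := (hT.adj_or_adj hac).resolve_left hn
      refine h v a b c hva hvb hvc (hT.ne_of_adj hab) hac (hT.ne_of_adj hbc) ⟨h1, h2, ?_, ?_⟩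
      · rw [hT.skewAdj_eq_one_iff.mpr hab, hT.skewAdj_eq_one_iff.mpr hbc]
      · rw [hT.skewAdj_eq_one_iff.mpr hbc, hT.skewAdj_eq_one_iff.mpr hca]
    refine ⟨⟨hind _, ?_⟩, ⟨hind _, ?_⟩⟩
    · rintro ⟨a, ha⟩ ⟨b, hb⟩ ⟨c, hc⟩ hab hbc
      refine hcyc a b c (hT.ne_of_adj ha) (hT.ne_of_adj hb) (hT.ne_of_adj hc) ?_ ?_ hab hbc
      · rw [hT.skewAdj_eq_one_iff.mpr ha, hT.skewAdj_eq_one_iff.mpr hb]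
      · rw [hT.skewAdj_eq_one_iff.mpr hb, hT.skewAdj_eq_one_iff.mpr hc]
    · rintro ⟨a, ha⟩ ⟨b, hb⟩ ⟨c, hc⟩ hab hbc
      refine hcyc a b c (hT.ne_of_adj ha).symm (hT.ne_of_adj hb).symm (hT.ne_of_adj hc).symm
        ?_ ?_ hab hbc
      · rw [hT.skewAdj_eq_neg_one_iff.mpr ha, hT.skewAdj_eq_neg_one_iff.mpr hb]
      · rw [hT.skewAdj_eq_neg_one_iff.mpr hb, hT.skewAdj_eq_neg_one_iff.mpr hc]

theorem isLocallyTransitive_iff_pfaffianFour (hT : T.IsTournament) :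
    T.IsLocallyTransitive ↔ ∀ v a b c, v ≠ a → v ≠ b → v ≠ c → a ≠ b → a ≠ c → b ≠ c →
      T.skewAdj.pfaffianFour v a b c ^ 2 = 1 := by
  rw [hT.isLocallyTransitive_iff]
  constructor
  · intro h v a b c hva hvb hvc hab hac hbc
    have h1 := h v a b c hva hvb hvc hab hac hbc
    have h2 := h a v b c hva.symm hab hac hvb hvc hbc
    have h3 := h b v a c hvb.symm hab.symm hbc hva hvc hac
    have h4 := h c v a b hvc.symm hac.symm hbc.symm hva hvb hab
    rw [T.skewAdj_swap a c] at h1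
    rw [T.skewAdj_swap v a, T.skewAdj_swap v c] at h2
    rw [T.skewAdj_swap v b, T.skewAdj_swap a b, T.skewAdj_swap v c] at h3
    rw [T.skewAdj_swap v c, T.skewAdj_swap a c, T.skewAdj_swap b c, T.skewAdj_swap v b] at h4
    unfold pfaffianFour
    rcases hT.skewAdj_eq_one_or hva with e1 | e1 <;>
    rcases hT.skewAdj_eq_one_or hvb with e2 | e2 <;>
    rcases hT.skewAdj_eq_one_or hvc with e3 | e3 <;>
    rcases hT.skewAdj_eq_one_or hab with e4 | e4 <;>
    rcases hT.skewAdj_eq_one_or hac with e5 | e5 <;>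
    rcases hT.skewAdj_eq_one_or hbc with e6 | e6 <;>
      simp only [e1, e2, e3, e4, e5, e6] at h1 h2 h3 h4 ⊢ <;> revert h1 h2 h3 h4 <;> decide
  · rintro h v a b c hva hvb hvc hab hac hbc ⟨h1, h2, h3, h4⟩
    have hp := h v a b c hva hvb hvc hab hac hbc
    rw [pfaffianFour, T.skewAdj_swap c a, ← h4, ← h2, ← h1, ← h3] at hp
    rcases hT.skewAdj_eq_one_or hva with e1 | e1 <;>
    rcases hT.skewAdj_eq_one_or hab with e2 | e2 <;>
      rw [e1, e2] at hp <;> norm_num at hp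

end IsTournament

end Digraph

/-! ### Counting all arborescences of a tournament -/

namespace Digraph

variable {V : Type*} {T : Digraph V}

/-- The principal submatrix of the skew-adjacency matrix on a set `s` of vertices. -/
noncomputable abbrev skewSub (T : Digraph V) (s : Finset V) : Matrix s s ℤ :=
  T.skewAdj.submatrix Subtype.val Subtype.val

theorem skewSub_transpose (T : Digraph V) (s : Finset V) :
    (T.skewSub s)ᵀ = -T.skewSub s := by
  rw [transpose_submatrix, skewAdj_transpose]
  rfl

namespace IsTournament

theorem skewSub_sign (hT : T.IsTournament) (s : Finset V) (i j : s) (hij : i ≠ j) :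
    T.skewSub s i j = 1 ∨ T.skewSub s i j = -1 :=
  hT.skewAdj_eq_one_or fun h => hij (Subtype.ext h)

variable [DecidableEq V]

theorem one_le_det_skewSub (hT : T.IsTournament) {s : Finset V} (hs : Even #s) :
    1 ≤ (T.skewSub s).det := by
  refine one_le_det_of_skew (skewSub_transpose T s) (fun i j hij => ?_) (by simpa using hs)
  rcases hT.skewSub_sign s i j hij with h | h <;> rw [h] <;> decide

theorem det_skewSub_of_odd (T : Digraph V) {s : Finset V} (hs : Odd #s) :
    (T.skewSub s).det = 0 :=
  det_eq_zero_of_skew_of_odd_card (skewSub_transpose T s) (by simpa using hs)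

/-- A tournament is locally transitive exactly when all even principal minors of its skew-adjacency
matrix take the least possible value; the minors of order four already detect this. -/
theorem isLocallyTransitive_iff_det_skewSub (hT : T.IsTournament) :
    T.IsLocallyTransitive ↔ ∀ s : Finset V, Even #s → (T.skewSub s).det = 1 := by
  rw [hT.isLocallyTransitive_iff_pfaffianFour]
  constructor
  · intro h s hs
    refine det_eq_one_of_pfaffianFour (skewSub_transpose T s) (hT.skewSub_sign s) ?_
      (by simpa using hs)
    intro i j k l hij hik hil hjk hjl hkl
    rw [← Subtype.coe_ne_coe] at hij hik hil hjk hjl hkl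
    exact h i j k l hij hik hil hjk hjl hkl
  · intro h v a b c hva hvb hvc hab hac hbc
    rw [← det_submatrix_four T.skewAdj_transpose]
    have hinj : Function.Injective ![v, a, b, c] := by
      intro i j hij
      fin_cases i <;> fin_cases j <;> simp_all
    let s : Finset V := univ.map ⟨_, hinj⟩
    let e : Fin 4 ≃ s := Equiv.ofBijective
      (fun i => ⟨![v, a, b, c] i, mem_map_of_mem ⟨_, hinj⟩ (mem_univ i)⟩)
      ⟨fun i j hij => hinj (congrArg Subtype.val hij), by
        rintro ⟨x, hx⟩
        obtain ⟨i, -, hi⟩ := mem_map.mp hx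
        exact ⟨i, Subtype.ext hi⟩⟩
    have hs : #s = 4 := by simp [s]
    rw [← h s (by rw [hs]; decide), ← det_submatrix_equiv_self e]
    rfl

variable [Fintype V]

/-- Adding half the all-ones matrix to the Laplacian makes its off-diagonal part skew. -/
theorem laplacian_add_half (hT : T.IsTournament) :
    T.laplacian + of (fun _ _ => (1 / 2 : ℝ)) =
      (-(1 / 2) : ℝ) • T.skewAdj.map (Int.cast : ℤ → ℝ) +
        diagonal fun v => (T.outDegree v : ℝ) + 1 / 2 := by
  ext v w
  by_cases hvw : v = w
  · subst hvw
    simp [laplacian, skewAdj, hT.loopless]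
  · have hne := Ne.symm hvw
    rcases hT.adj_or_adj hvw with h | h <;>
      simp [laplacian, skewAdj, h, hT.not_adj_swap h, hvw, hne]
    norm_num

theorem card_mul_allarb [Nonempty V] (hT : T.IsTournament) :
    (Fintype.card V : ℝ) * T.allarb =
      ∑ s : Finset V, 2 * (-(1 / 2)) ^ #s * ((T.skewSub s).det : ℝ) *
        ∏ v ∈ univ \ s, ((T.outDegree v : ℝ) + 1 / 2) := by
  have h1 := det_add_const_of_sum_row_eq_zero T.laplacian T.sum_laplacian (1 / 2)
  rw [hT.laplacian_add_half, det_add_diagonal] at h1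
  have h2 : (T.allarb : ℝ) = ∑ v, (T.laplacian.updateRow v (Pi.single v 1)).det := by
    simp only [det_updateRow_laplacian, allarb, Nat.cast_sum]
  rw [← h2] at h1
  have h3 : (Fintype.card V : ℝ) * T.allarb = 2 * (1 / 2 * Fintype.card V * T.allarb) := by ring
  rw [h3, ← h1, Finset.mul_sum]
  refine Finset.sum_congr rfl fun s _ => ?_
  have h4 : ((-(1 / 2) : ℝ) • T.skewAdj.map (Int.cast : ℤ → ℝ)).submatrix
      (Subtype.val : s → V) Subtype.val = (-(1 / 2) : ℝ) • (T.skewSub s).map Int.cast := rfl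
  have h5 : ((T.skewSub s).map (Int.cast : ℤ → ℝ)).det = (T.skewSub s).det :=
    (Int.cast_det _).symm
  rw [h4, det_smul, h5, Fintype.card_coe]
  ring

/-- The product formula is the value of the expansion when every even principal minor is `1`: the
shifts of `d + 1 / 2` by `± 1 / 2` are expanded over subsets, and the odd subsets cancel. -/
theorem card_mul_allarb_sub [Nonempty V] (hT : T.IsTournament) :
    (Fintype.card V : ℝ) * T.allarb -
        ((∏ v, ((T.outDegree v : ℝ) + 1)) + ∏ v, (T.outDegree v : ℝ)) =
      ∑ s : Finset V with Even #s, 2 * (1 / 2) ^ #s *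
        (∏ v ∈ univ \ s, ((T.outDegree v : ℝ) + 1 / 2)) * ((T.skewSub s).det - 1) := by
  have hprod : ∀ x : ℝ, ∏ v, (x + ((T.outDegree v : ℝ) + 1 / 2)) =
      ∑ s : Finset V, x ^ #s * ∏ v ∈ univ \ s, ((T.outDegree v : ℝ) + 1 / 2) := by
    intro x
    rw [Finset.prod_add, Finset.powerset_univ]
    simp only [Finset.prod_const]
  have h1 : ∏ v, ((T.outDegree v : ℝ) + 1) =
      ∏ v, (1 / 2 + ((T.outDegree v : ℝ) + 1 / 2)) :=
    Finset.prod_congr rfl fun v _ => by ring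
  have h2 : ∏ v, (T.outDegree v : ℝ) = ∏ v, (-(1 / 2) + ((T.outDegree v : ℝ) + 1 / 2)) :=
    Finset.prod_congr rfl fun v _ => by ring
  rw [hT.card_mul_allarb, h1, h2, hprod, hprod, ← Finset.sum_add_distrib,
    ← Finset.sum_sub_distrib, Finset.sum_filter]
  refine Finset.sum_congr rfl fun s _ => ?_
  split_ifs with hs
  · rw [hs.neg_pow]
    ring
  · rw [Nat.not_even_iff_odd] at hs
    rw [det_skewSub_of_odd T hs, hs.neg_pow]
    push_cast
    ring

end IsTournament

end Digraph

theorem mainTheorem1 {V : Type*} [Fintype V] [Nonempty V] (T : Digraph V) (hT : T.IsTournament) :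
    (1 / (Fintype.card V : ℝ)) *
        ((∏ v, ((T.outDegree v : ℝ) + 1)) + ∏ v, (T.outDegree v : ℝ)) ≤ (T.allarb : ℝ) ∧
      ((T.allarb : ℝ) =
          (1 / (Fintype.card V : ℝ)) *
            ((∏ v, ((T.outDegree v : ℝ) + 1)) + ∏ v, (T.outDegree v : ℝ)) ↔
        T.IsLocallyTransitive) := by
  classical
  have hcard : (0 : ℝ) < Fintype.card V := by exact_mod_cast Fintype.card_pos
  have hkey := hT.card_mul_allarb_sub
  have hweight : ∀ s : Finset V, 0 < 2 * (1 / 2 : ℝ) ^ #s *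
      ∏ v ∈ univ \ s, ((T.outDegree v : ℝ) + 1 / 2) := fun s => by positivity
  have hterm : ∀ s ∈ (univ : Finset (Finset V)).filter (fun s => Even #s),
      0 ≤ 2 * (1 / 2 : ℝ) ^ #s * (∏ v ∈ univ \ s, ((T.outDegree v : ℝ) + 1 / 2)) *
        (((T.skewSub s).det : ℝ) - 1) := by
    intro s hs
    refine mul_nonneg (hweight s).le (sub_nonneg.mpr ?_)
    exact_mod_cast hT.one_le_det_skewSub (mem_filter.mp hs).2
  rw [one_div_mul_eq_div]
  constructor
  · rw [div_le_iff₀ hcard, mul_comm, ← sub_nonneg, hkey]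
    exact Finset.sum_nonneg hterm
  · rw [eq_div_iff hcard.ne', mul_comm, ← sub_eq_zero, hkey, Finset.sum_eq_zero_iff_of_nonneg hterm,
      hT.isLocallyTransitive_iff_det_skewSub]
    refine forall_congr' fun s => ?_
    rw [mem_filter, and_iff_right (mem_univ s), mul_eq_zero, or_iff_right (hweight s).ne',
      sub_eq_zero]
    norm_cast
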